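/- Let $N\ge 1$ be an integer, let $\rho$ be a Borel probability measure on $\mathbb R^3$, and let $$c(x_1,\dots,x_N)=\sum_{1\le i<j\le N}\frac1{|x_i-x_j|}\in[0,+\infty]\qquad (x_1,\dots,x_N\in\mathbb R^3)$$ be the Coulomb cost, with $c=+\infty$ whenever $x_i=x_j$ for some $i\neq j$. Let $\Pi(\rho)$ be the set of Borel probability measures $P$ on $(\mathbb R^3)^N$ all of whose $N$ marginals on $\mathbb R^3$ are equal to $\rho$, and let $\rho^N=\rho\otimes\dots\otimes\rho$. Then the minimum below is attained, and in $[0,+\infty]$ $$\min_{P\in\Pi(\rho)}\int c\,dP=\sup\Big\{N\int u\,d\rho \ :\ u\in L^1_\rho,\ u(x_1)+\dots+u(x_N)\le c(x_1,\dots,x_N)\ \text{ for }\rho^N\text{-a.e. }(x_1,\dots,x_N)\Big\}.$$ If moreover $\rho$ has no atoms (that is, $\rho(\{x\})=0$ for every $x\in\mathbb R^3$), then the supremum on the right-hand side is attained by a bounded function $u$ (in particular, the common value is finite). -/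

import Mathlib

open MeasureTheory
open scoped ENNReal

namespace CoulombOT

/-- The Euclidean space `ℝ³`, with its Euclidean norm and Borel σ-algebra. -/
abbrev Space3 : Type := EuclideanSpace ℝ (Fin 3)

/-- The Coulomb cost `c(x₁, …, x_N) = ∑_{i < j} 1 / |x_i - x_j|`, with values in `[0, ∞]`.
The inverse is that of `ℝ≥0∞`, so the cost is `∞` when two of the points coincide. -/
noncomputable def coulombCost {N : ℕ} (x : Fin N → Space3) : ℝ≥0∞ :=
  ∑ i : Fin N, ∑ j : Fin N with i < j, (ENNReal.ofReal ‖x i - x j‖)⁻¹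

/-- The set `Π(ρ)` of transport plans: the Borel probability measures on `(ℝ³)^N` all of whose
`N` marginals are equal to `ρ`. -/
def transportPlans (N : ℕ) (ρ : Measure Space3) : Set (Measure (Fin N → Space3)) :=
  {P | IsProbabilityMeasure P ∧ ∀ i : Fin N, P.map (fun x => x i) = ρ}

/-- The total cost `∫ c dP` of a plan, with values in `[0, ∞]`. -/
noncomputable def planCost {N : ℕ} (P : Measure (Fin N → Space3)) : ℝ≥0∞ :=
  ∫⁻ x, coulombCost x ∂P

/-- The set of admissible potentials: `u ∈ L¹(ρ)` with
`u(x₁) + ⋯ + u(x_N) ≤ c(x₁, …, x_N)` for `ρ^N`-almost every `(x₁, …, x_N)`. -/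
def admissiblePotentials (N : ℕ) (ρ : Measure Space3) : Set (Space3 → ℝ) :=
  {u | Integrable u ρ ∧
    ∀ᵐ x ∂(Measure.pi fun _ : Fin N => ρ),
      ((∑ i : Fin N, u (x i) : ℝ) : EReal) ≤ (coulombCost x : EReal)}

/-- The dual objective `N ∫ u dρ`. -/
noncomputable def dualObjective (N : ℕ) (ρ : Measure Space3) (u : Space3 → ℝ) : ℝ :=
  (N : ℝ) * ∫ x, u x ∂ρ

/-- The value of the dual problem, a supremum in `[-∞, ∞]`. -/
noncomputable def dualValue (N : ℕ) (ρ : Measure Space3) : EReal :=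
  ⨆ u ∈ admissiblePotentials N ρ, (dualObjective N ρ u : EReal)

end CoulombOT

open MeasureTheory Filter Topology
open scoped ENNReal BoundedContinuousFunction CompactlySupported

/-! Weak duality is delicate because admissibility holds only `ρ^N`-a.e., while a plan may be
singular to `ρ^N`. Since `c` is continuous into `[0, ∞]`, `exists_conull_forall_sum_le` makes the
constraint hold everywhere on `A^N` for some `ρ`-conull `A`, and every plan is concentrated on
`A^N`. Conversely, truncating pair interactions at `n + 1` gives bounded continuous symmetric costs
increasing to `c`, whose dual values are at most that of `c`. M. Riesz's extension theorem
(`exists_plan_integral_le`) yields one plan whose truncated costs are all bounded by the dual value,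
and Fatou's lemma passes to `c`. If `ρ` has no atoms, small balls have uniformly small mass. A
truncated problem has a bounded dual maximiser `u`, which saturates its constraint almost everywhere
for an optimal truncated plan. Exchanging one point with a far configuration
(`truncPair_le_of_swap`) bounds the pair interactions on that plan independently of the truncation
level, so for a high level truncated and true costs agree there and `u` is optimal for `c`. -/

namespace CoulombOT

/-! ### Preliminaries: convex maximisation, almost-everywhere constraints, small balls. -/

/-- In a Hilbert space, a continuous linear functional attains its supremum on a nonempty bounded
closed convex set. -/
theorem exists_forall_le_of_isClosed_convex {H : Type*} [NormedAddCommGroup H]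
    [InnerProductSpace ℝ H] [CompleteSpace H] {K : Set H} (hne : K.Nonempty) (hc : IsClosed K)
    (hconv : Convex ℝ K) (hb : Bornology.IsBounded K) (l : H →L[ℝ] ℝ) :
    ∃ v ∈ K, ∀ w ∈ K, l w ≤ l v := by
  have hbdd : BddAbove (l '' K) := (l.lipschitz.isBounded_image hb).bddAbove
  set s := sSup (l '' K)
  -- The least-norm points of these nested slices form a Cauchy sequence, and the limit lies in
  -- every slice.
  let Ks : ℕ → Set H := fun k => K ∩ {f | s - 1 / ((k : ℝ) + 1) ≤ l f}
  have hKne : ∀ k, (Ks k).Nonempty := by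
    intro k
    obtain ⟨_, ⟨f, hf, rfl⟩, hlt⟩ := exists_lt_of_lt_csSup (hne.image l)
      (show s - 1 / ((k : ℝ) + 1) < s by have : 0 < 1 / ((k : ℝ) + 1) := by positivity
                                         linarith)
    exact ⟨f, hf, hlt.le⟩
  have hKc : ∀ k, IsClosed (Ks k) := fun k =>
    hc.inter (isClosed_le continuous_const l.continuous)
  have hKconv : ∀ k, Convex ℝ (Ks k) := fun k =>
    hconv.inter (convex_halfSpace_ge l.toLinearMap.isLinear _)
  have hanti : Antitone Ks := by
    intro j k hjk f hf
    refine ⟨hf.1, (?_ : s - 1 / ((j : ℝ) + 1) ≤ _).trans hf.2⟩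
    have := one_div_le_one_div_of_le (by positivity : (0 : ℝ) < (j : ℝ) + 1)
      (by gcongr : (j : ℝ) + 1 ≤ (k : ℝ) + 1)
    linarith
  have hmin : ∀ k, ∃ v ∈ Ks k, ∀ w ∈ Ks k, ‖v‖ ≤ ‖w‖ := by
    intro k
    obtain ⟨v, hv, hvn⟩ := exists_norm_eq_iInf_of_complete_convex (hKne k) (hKc k).isComplete
      (hKconv k) 0
    refine ⟨v, hv, fun w hw => ?_⟩
    have : (⨅ w : Ks k, ‖(0 : H) - w‖) ≤ ‖(0 : H) - w‖ :=
      ciInf_le (f := fun w : Ks k => ‖(0 : H) - w‖)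
        ⟨0, by rintro _ ⟨w, rfl⟩; exact norm_nonneg _⟩ ⟨w, hw⟩
    rw [← hvn] at this
    simpa using this
  choose v hv hvmin using hmin
  have hmono : Monotone fun k => ‖v k‖ ^ 2 := fun j k hjk => by
    exact pow_le_pow_left₀ (norm_nonneg _) (hvmin j _ (hanti hjk (hv k))) 2
  obtain ⟨B, hB⟩ := hb.exists_norm_le
  have hlim := tendsto_atTop_ciSup hmono
    ⟨B ^ 2, by rintro _ ⟨k, rfl⟩; exact pow_le_pow_left₀ (norm_nonneg _) (hB _ (hv k).1) 2⟩
  have hpar : ∀ j k, j ≤ k → ‖v j - v k‖ ^ 2 ≤ 2 * (‖v k‖ ^ 2 - ‖v j‖ ^ 2) := by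
    intro j k hjk
    -- The midpoint stays in the larger slice, so its norm is at least `‖v j‖`; the parallelogram
    -- law does the rest.
    have hmid : (1 / 2 : ℝ) • v j + (1 / 2 : ℝ) • v k ∈ Ks j :=
      hKconv j (hv j) (hanti hjk (hv k)) (by norm_num) (by norm_num) (by norm_num)
    have h1 := hvmin j _ hmid
    rw [← smul_add, norm_smul] at h1
    norm_num at h1
    have h2 := parallelogram_law_with_norm ℝ (v j) (v k)
    have h3 : (2 * ‖v j‖) ^ 2 ≤ ‖v j + v k‖ ^ 2 :=
      pow_le_pow_left₀ (by positivity) (by linarith) 2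
    nlinarith
  have hcau : CauchySeq v := by
    rw [Metric.cauchySeq_iff']
    intro ε hε
    obtain ⟨n, hn⟩ := Metric.cauchySeq_iff'.1 hlim.cauchySeq (ε ^ 2 / 2) (by positivity)
    refine ⟨n, fun k hk => ?_⟩
    have h1 := hpar n k hk
    have h2 := (abs_lt.1 (Real.dist_eq _ _ ▸ hn k hk)).2
    rw [dist_comm, dist_eq_norm]
    exact lt_of_pow_lt_pow_left₀ 2 hε.le (by linarith)
  obtain ⟨f, hf⟩ := cauchySeq_tendsto_of_complete hcau
  have hfK : ∀ k, f ∈ Ks k := fun k => (hKc k).mem_of_tendsto hf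
    ((eventually_ge_atTop k).mono fun j hj => hanti hj (hv j))
  refine ⟨f, (hfK 0).1, fun w hw => (le_csSup hbdd ⟨w, hw, rfl⟩).trans ?_⟩
  refine le_of_tendsto (f := fun k : ℕ => s - 1 / ((k : ℝ) + 1)) (x := atTop) ?_
    (Eventually.of_forall fun k => (hfK k).2)
  simpa using tendsto_const_nhds.sub (tendsto_one_div_add_atTop_nhds_zero_nat (𝕜 := ℝ))

/-- A constraint `∑ u(xᵢ) ≤ c(x)` holding almost everywhere for a product measure, with `c` upper
semicontinuous, holds at every point whose coordinates lie in a suitable conull set. -/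
theorem exists_conull_forall_sum_le {N : ℕ} {X : Type*} [TopologicalSpace X]
    [SecondCountableTopology X] [MeasurableSpace X] (ρ : Measure X)
    [IsProbabilityMeasure ρ] {u : X → ℝ} {c : (Fin N → X) → EReal}
    (hc : ∀ q : ℝ, IsOpen {x | c x < (q : EReal)})
    (h : ∀ᵐ x ∂(Measure.pi fun _ : Fin N => ρ), ((∑ i, u (x i) : ℝ) : EReal) ≤ c x) :
    ∃ A : Set X, (∀ᵐ t ∂ρ, t ∈ A) ∧
      ∀ x : Fin N → X, (∀ i, x i ∈ A) → ((∑ i, u (x i) : ℝ) : EReal) ≤ c x := by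
  let 𝓑 := TopologicalSpace.countableBasis X
  -- Each pair `(q, B)` discards only a null set of points, and there are countably many pairs.
  refine ⟨{t | ∀ q : ℚ, (q : ℝ) < u t → ∀ B ∈ 𝓑, t ∈ B → ρ (B ∩ {s | (q : ℝ) < u s}) ≠ 0},
    ?_, ?_⟩
  · simp only [Set.mem_ofPred_eq]
    rw [ae_all_iff]
    intro q
    have : ∀ᵐ t ∂ρ, ∀ B ∈ 𝓑, (q : ℝ) < u t → t ∈ B → ρ (B ∩ {s | (q : ℝ) < u s}) ≠ 0 := by
      rw [ae_ball_iff (TopologicalSpace.countable_countableBasis X)]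
      intro B _
      by_cases h0 : ρ (B ∩ {s | (q : ℝ) < u s}) = 0
      · filter_upwards [measure_eq_zero_iff_ae_notMem.1 h0] with t ht hqt htB
        exact absurd ⟨htB, hqt⟩ ht
      · exact Eventually.of_forall fun t _ _ => h0
    filter_upwards [this] with t ht hqt B hB htB using ht B hB hqt htB
  · intro x hx
    by_contra! hlt
    obtain ⟨s, hcs, hsu⟩ := EReal.lt_iff_exists_real_btwn.1 hlt
    rw [EReal.coe_lt_coe_iff] at hsu
    -- Losing `η` in each coordinate costs `N * η`, less than the available gap; `N + 1` also covers
    -- `N = 0`.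
    set η : ℝ := (∑ i, u (x i) - s) / (N + 1) with hη
    have hη0 : 0 < η := by have := sub_pos.2 hsu; positivity
    have hq : ∀ i, ∃ q : ℚ, u (x i) - η < q ∧ (q : ℝ) < u (x i) := fun i =>
      exists_rat_btwn (by linarith)
    choose q hq1 hq2 using hq
    have hsq : s ≤ ∑ i, (q i : ℝ) := by
      have h1 : ∑ i, (u (x i) - η) ≤ ∑ i, (q i : ℝ) :=
        Finset.sum_le_sum fun i _ => (hq1 i).le
      have h2 : ∑ i, u (x i) - s = η * (N + 1) := by rw [hη]; field_simp
      simp only [Finset.sum_sub_distrib, Finset.sum_const, Finset.card_univ, Fintype.card_fin,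
        nsmul_eq_mul] at h1
      linarith
    obtain ⟨V, hV, hVs⟩ := isOpen_pi_iff'.1 (hc s) x hcs
    have hB : ∀ i, ∃ B ∈ 𝓑, x i ∈ B ∧ B ⊆ V i := fun i =>
      (TopologicalSpace.isBasis_countableBasis X).exists_subset_of_mem_open (hV i).2 (hV i).1
    choose B hB𝓑 hxB hBV using hB
    -- A violation at `x` spreads to a box whose sides all have positive mass.
    have hsub : (Set.univ.pi fun i => B i ∩ {t | (q i : ℝ) < u t}) ⊆
        {y | ¬ ((∑ i, u (y i) : ℝ) : EReal) ≤ c y} := by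
      intro y hy hle
      have h1 : c y < s := hVs fun i hi => hBV i (hy i trivial).1
      have h2 : ∑ i, (q i : ℝ) ≤ ∑ i, u (y i) := Finset.sum_le_sum fun i _ => (hy i trivial).2.le
      exact absurd (hle.trans_lt h1) (not_lt.2 (by exact_mod_cast hsq.trans h2))
    have hnull := measure_mono_null hsub (ae_iff.1 h)
    rw [Measure.pi_pi, Finset.prod_eq_zero_iff] at hnull
    obtain ⟨i, -, hi⟩ := hnull
    exact hx i (q i) (hq2 i) (B i) (hB𝓑 i) (hxB i) hi

/-- A finite measure without atoms is uniformly small on small balls. -/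
theorem exists_forall_measure_ball_lt {X : Type*} [MetricSpace X] [ProperSpace X]
    [MeasurableSpace X] [BorelSpace X] (ρ : Measure X) [IsFiniteMeasure ρ]
    (h : ∀ x, ρ {x} = 0) {ε : ℝ≥0∞} (hε : 0 < ε) :
    ∃ r : ℝ, 0 < r ∧ ∀ x, ρ (Metric.ball x r) < ε := by
  obtain ⟨K, hK, hKε⟩ : ∃ K : Set X, IsCompact K ∧ ρ Kᶜ < ε := by
    obtain ⟨K, -, hK, hKε⟩ := MeasurableSet.univ.exists_isCompact_sdiff_lt
      (measure_ne_top ρ Set.univ) hε.ne'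
    exact ⟨K, hK, by rwa [Set.compl_eq_univ_sdiff]⟩
  have hloc : ∀ x, ∃ r : ℝ, 0 < r ∧ ρ (Metric.ball x r) < ε := by
    intro x
    obtain ⟨U, hxU, hU, hUε⟩ := Set.exists_isOpen_lt_of_lt {x} ε ((h x).trans_lt hε)
    obtain ⟨r, hr, hrU⟩ := Metric.isOpen_iff.1 hU x (hxU rfl)
    exact ⟨r, hr, (measure_mono hrU).trans_lt hUε⟩
  choose r hr hrε using hloc
  obtain ⟨δ, hδ, hδK⟩ := lebesgue_number_lemma_of_metric (c := fun x => Metric.ball x (r x)) hK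
    (fun x => Metric.isOpen_ball) (fun x _ => Set.mem_iUnion.2 ⟨x, Metric.mem_ball_self (hr x)⟩)
  -- A ball of radius `δ / 2` meeting `K` lies in a `δ`-ball centred in `K`; otherwise it lies in
  -- `Kᶜ`.
  refine ⟨δ / 2, by positivity, fun x => ?_⟩
  by_cases hx : (Metric.ball x (δ / 2) ∩ K).Nonempty
  · obtain ⟨z, hz, hzK⟩ := hx
    obtain ⟨y, hy⟩ := hδK z hzK
    refine (measure_mono ?_).trans_lt (hrε y)
    refine (Metric.ball_subset_ball' ?_).trans hy
    rw [Metric.mem_ball, dist_comm] at hz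
    linarith
  · refine (measure_mono fun z hz hzK => hx ⟨z, hz, hzK⟩).trans_lt hKε

/-! ### Riesz representation without loss of mass. -/

/-- The cutoff equal to `1` on the ball of radius `k` and to `0` off the ball of radius `k + 1`. -/
noncomputable def cutoff (Y : Type*) [NormedAddCommGroup Y] (k : ℕ) : Y →ᵇ ℝ :=
  .ofNormedAddCommGroup (fun y => max 0 (min 1 ((k : ℝ) + 1 - ‖y‖))) (by fun_prop) 1 fun y => by
    rw [Real.norm_of_nonneg (le_max_left _ _)]
    exact max_le zero_le_one (min_le_left _ _)

section Cutoff

variable {Y : Type*} [NormedAddCommGroup Y]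

theorem cutoff_apply (k : ℕ) (y : Y) : cutoff Y k y = max 0 (min 1 ((k : ℝ) + 1 - ‖y‖)) := rfl

theorem cutoff_nonneg (k : ℕ) (y : Y) : 0 ≤ cutoff Y k y := le_max_left _ _

theorem cutoff_le_one (k : ℕ) (y : Y) : cutoff Y k y ≤ 1 :=
  max_le zero_le_one (min_le_left _ _)

theorem cutoff_eq_one {k : ℕ} {y : Y} (h : ‖y‖ ≤ k) : cutoff Y k y = 1 := by
  rw [cutoff_apply, min_eq_left (by linarith), max_eq_right zero_le_one]

theorem tendsto_cutoff (y : Y) : Tendsto (fun k => cutoff Y k y) atTop (𝓝 1) := by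
  obtain ⟨n, hn⟩ := exists_nat_ge ‖y‖
  refine tendsto_const_nhds.congr' ((eventually_ge_atTop n).mono fun k hk => ?_)
  exact (cutoff_eq_one (hn.trans (by exact_mod_cast hk))).symm

theorem hasCompactSupport_cutoff [ProperSpace Y] (k : ℕ) : HasCompactSupport (cutoff Y k) := by
  refine HasCompactSupport.intro (isCompact_closedBall (0 : Y) (k + 1)) fun y hy => ?_
  rw [mem_closedBall_zero_iff, not_le] at hy
  rw [cutoff_apply, max_eq_left]
  exact (min_le_right _ _).trans (by linarith)

/-- Riesz representation: a positive normalised linear functional on the bounded continuous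
functions is integration against a probability measure as soon as no mass escapes to infinity. -/
theorem exists_isProbabilityMeasure_integral_eq [ProperSpace Y] [MeasurableSpace Y] [BorelSpace Y]
    (L : (Y →ᵇ ℝ) →ₗ[ℝ] ℝ) (hL : ∀ f, (∀ y, 0 ≤ f y) → 0 ≤ L f) (h1 : L 1 = 1)
    (ht : Tendsto (fun k => L (cutoff Y k)) atTop (𝓝 1)) :
    ∃ P : Measure Y, IsProbabilityMeasure P ∧ ∀ f : Y →ᵇ ℝ, ∫ y, f y ∂P = L f := by
  have hmono : ∀ f g : Y →ᵇ ℝ, (∀ y, f y ≤ g y) → L f ≤ L g := fun f g h => by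
    have := hL (g - f) fun y => sub_nonneg.2 (h y)
    rwa [map_sub, sub_nonneg] at this
  let Λ : C_c(Y, ℝ) →ₚ[ℝ] ℝ := PositiveLinearMap.mk₀
    { toFun := fun f => L f.toBoundedContinuousFunction
      map_add' := fun f g => by rw [← map_add]; rfl
      map_smul' := fun a f => by rw [RingHom.id_apply, ← map_smul]; rfl }
    fun f hf => hL _ hf
  set P := RealRMK.rieszMeasure Λ
  have hP : ∀ f : Y →ᵇ ℝ, HasCompactSupport f → ∫ y, f y ∂P = L f := fun f hf =>
    RealRMK.integral_rieszMeasure Λ ⟨f.toContinuousMap, hf⟩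
  have hle : ∀ f : Y →ᵇ ℝ, (∀ y, 0 ≤ f y) →
      ∫⁻ y, ENNReal.ofReal (f y) ∂P ≤ ENNReal.ofReal (L f) := by
    intro f hf
    have hlim : ∀ y, liminf (fun k => ENNReal.ofReal ((f * cutoff Y k) y)) atTop
        = ENNReal.ofReal (f y) := fun y => by
      refine Tendsto.liminf_eq (ENNReal.tendsto_ofReal ?_)
      simpa using (tendsto_cutoff y).const_mul (f y)
    have hk : ∀ k, ∫⁻ y, ENNReal.ofReal ((f * cutoff Y k) y) ∂P ≤ ENNReal.ofReal (L f) := by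
      intro k
      have hcs : HasCompactSupport (f * cutoff Y k) := (hasCompactSupport_cutoff k).mul_left
      rw [← ofReal_integral_eq_lintegral_ofReal
        ((f * cutoff Y k).continuous.integrable_of_hasCompactSupport hcs)
        (Eventually.of_forall fun y => mul_nonneg (hf y) (cutoff_nonneg k y)), hP _ hcs]
      exact ENNReal.ofReal_le_ofReal
        (hmono _ _ fun y => mul_le_of_le_one_right (hf y) (cutoff_le_one k y))
    calc ∫⁻ y, ENNReal.ofReal (f y) ∂P
        = ∫⁻ y, liminf (fun k => ENNReal.ofReal ((f * cutoff Y k) y)) atTop ∂P := by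
          simp only [hlim]
      _ ≤ liminf (fun k => ∫⁻ y, ENNReal.ofReal ((f * cutoff Y k) y) ∂P) atTop :=
          lintegral_liminf_le fun k => (f * cutoff Y k).continuous.measurable.ennreal_ofReal
      _ ≤ liminf (fun _ : ℕ => ENNReal.ofReal (L f)) atTop := liminf_le_liminf (.of_forall hk)
      _ = ENNReal.ofReal (L f) := liminf_const _
  have hfin : P Set.univ ≤ 1 := by
    simpa [h1] using hle 1 fun y => zero_le_one
  have : IsFiniteMeasure P := ⟨hfin.trans_lt ENNReal.one_lt_top⟩
  have hle' : ∀ f : Y →ᵇ ℝ, (∀ y, 0 ≤ f y) → ∫ y, f y ∂P ≤ L f := fun f hf => by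
    have := hle f hf
    rwa [← ofReal_integral_eq_lintegral_ofReal (f.integrable P) (.of_forall hf),
      ENNReal.ofReal_le_ofReal_iff (hL f hf)] at this
  have hprob : IsProbabilityMeasure P := by
    refine ⟨le_antisymm hfin ?_⟩
    have h2 : 1 ≤ P.real Set.univ := by
      refine le_of_tendsto ht (.of_forall fun k => ?_)
      rw [← hP _ (hasCompactSupport_cutoff k)]
      calc ∫ y, cutoff Y k y ∂P ≤ ∫ y, (1 : ℝ) ∂P :=
            integral_mono ((cutoff Y k).integrable P) (integrable_const _) (cutoff_le_one k)
        _ = P.real Set.univ := by simp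
    rw [← ENNReal.ofReal_one]
    exact ENNReal.ofReal_le_of_le_toReal h2
  refine ⟨P, hprob, fun f => ?_⟩
  have hb : ∀ y, |f y| ≤ ‖f‖ := f.norm_coe_le_norm
  -- Both `‖f‖ + f` and `‖f‖ - f` are nonnegative and constants are integrated exactly, so the
  -- one-sided bound gives equality.
  have h2 := hle' (‖f‖ • 1 + f) fun y => by
    have := neg_abs_le (f y)
    simp only [BoundedContinuousFunction.coe_add, BoundedContinuousFunction.coe_smul,
      BoundedContinuousFunction.coe_one, Pi.add_apply, Pi.one_apply, smul_eq_mul, mul_one]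
    linarith [hb y]
  have h3 := hle' (‖f‖ • 1 - f) fun y => by
    have := le_abs_self (f y)
    simp only [BoundedContinuousFunction.coe_sub, BoundedContinuousFunction.coe_smul,
      BoundedContinuousFunction.coe_one, Pi.sub_apply, Pi.one_apply, smul_eq_mul, mul_one]
    linarith [hb y]
  simp only [BoundedContinuousFunction.coe_add, BoundedContinuousFunction.coe_sub,
    BoundedContinuousFunction.coe_smul, BoundedContinuousFunction.coe_one, Pi.add_apply,
    Pi.sub_apply, Pi.one_apply, smul_eq_mul, mul_one, map_add, map_sub, map_smul, h1] at h2 h3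
  rw [integral_add (integrable_const _) (f.integrable P)] at h2
  rw [integral_sub (integrable_const _) (f.integrable P)] at h3
  simp only [integral_const, probReal_univ, one_smul] at h2 h3
  linarith

end Cutoff

/-! ### Kantorovich duality for bounded continuous costs. -/

section Duality

variable {N : ℕ} {X : Type*} [NormedAddCommGroup X]

/-- The linear map sending `(w₁, …, w_N)` to the function `x ↦ ∑ wᵢ(xᵢ)`. -/
noncomputable def sumCoord (N : ℕ) (X : Type*) [NormedAddCommGroup X] :
    (Fin N → (X →ᵇ ℝ)) →ₗ[ℝ] ((Fin N → X) →ᵇ ℝ) where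
  toFun w := ∑ i, (w i).compContinuous ⟨fun x => x i, continuous_apply i⟩
  map_add' v w := by ext x; simp [Finset.sum_add_distrib]
  map_smul' a w := by ext x; simp [Finset.mul_sum]

theorem sumCoord_apply (w : Fin N → (X →ᵇ ℝ)) (x : Fin N → X) :
    sumCoord N X w x = ∑ i, w i (x i) := by
  simp [sumCoord]

theorem sumCoord_const [NeZero N] (a : ℝ) :
    sumCoord N X (fun _ => (a / N) • 1) = a • 1 := by
  ext x
  have : (N : ℝ) ≠ 0 := NeZero.ne _
  rw [sumCoord_apply]
  simp
  field_simp

theorem sumCoord_single (i : Fin N) (φ : X →ᵇ ℝ) (x : Fin N → X) :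
    sumCoord N X (Pi.single i φ) x = φ (x i) := by
  rw [sumCoord_apply, Finset.sum_eq_single i]
  · simp
  · intro j _ hj
    simp [hj]
  · simp

/-- Some coordinate realises the sup norm of `x`. This transfers tightness from `ρ` to functionals
with marginals `ρ`. -/
theorem one_sub_sum_le_cutoff [NeZero N] (k : ℕ) (x : Fin N → X) :
    1 - ∑ i, (1 - cutoff X k (x i)) ≤ cutoff (Fin N → X) k x := by
  obtain ⟨i, hi⟩ : ∃ i, ‖x‖ ≤ ‖x i‖ := by
    by_contra! h
    exact lt_irrefl _ ((pi_norm_lt_iff ((norm_nonneg _).trans_lt (h 0))).2 h)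
  have h1 : 1 - cutoff X k (x i) ≤ ∑ i, (1 - cutoff X k (x i)) :=
    Finset.single_le_sum (f := fun i => 1 - cutoff X k (x i))
      (fun j _ => sub_nonneg.2 (cutoff_le_one k _)) (Finset.mem_univ i)
  have h2 : cutoff X k (x i) ≤ cutoff (Fin N → X) k x := by
    rw [cutoff_apply, cutoff_apply]
    gcongr
  linarith

variable [MeasurableSpace X] [BorelSpace X]

theorem integral_sumCoord [SecondCountableTopology X] (ρ : Measure X) [IsProbabilityMeasure ρ]
    (w : Fin N → (X →ᵇ ℝ)) :
    ∫ x, sumCoord N X w x ∂(Measure.pi fun _ : Fin N => ρ) = ∑ i, ∫ t, w i t ∂ρ := by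
  simp only [sumCoord_apply]
  have hmp : ∀ i : Fin N, MeasurePreserving (Function.eval i) (Measure.pi fun _ : Fin N => ρ) ρ :=
    measurePreserving_eval _
  rw [integral_finsetSum (f := fun i (x : Fin N → X) => w i (x i)) _
    fun i _ => (hmp i).integrable_comp_of_integrable ((w i).integrable ρ)]
  refine Finset.sum_congr rfl fun i _ => ?_
  have h1 := integral_map (μ := Measure.pi fun _ : Fin N => ρ) (φ := Function.eval i)
    (measurable_pi_apply i).aemeasurable (w i).continuous.aestronglyMeasurable
  rw [(hmp i).map_eq] at h1
  exact h1.symm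

/-- For a symmetric cost, a bound on the dual functional at equal potentials is a bound at arbitrary
ones. -/
theorem sum_integral_le_of_symmetric [NeZero N] (ρ : Measure X) [IsProbabilityMeasure ρ]
    {k : (Fin N → X) → ℝ} (hsymm : ∀ (σ : Equiv.Perm (Fin N)) x, k (x ∘ σ) = k x) {V : ℝ}
    (hV : ∀ u : X →ᵇ ℝ, (∀ x : Fin N → X, ∑ i, u (x i) ≤ k x) → N * ∫ t, u t ∂ρ ≤ V)
    (w : Fin N → (X →ᵇ ℝ)) (hw : ∀ x : Fin N → X, ∑ i, w i (x i) ≤ k x) :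
    ∑ i, ∫ t, w i t ∂ρ ≤ V := by
  have hN : (0 : ℝ) < N := by exact_mod_cast Nat.pos_of_neZero N
  -- Averaging over the `N` cyclic shifts suffices: `i + j`, taken modulo `N`, runs through all
  -- indices as `j` does.
  have h := hV ((N : ℝ)⁻¹ • ∑ i, w i) fun x => by
    have h1 : ∀ j : Fin N, ∑ i, w i (x (i + j)) ≤ k x := fun j =>
      (hw (x ∘ Equiv.addRight j)).trans_eq (hsymm _ x)
    have h2 : ∑ j, ∑ i, w i (x j) = ∑ j : Fin N, ∑ i, w i (x (i + j)) := by
      rw [Finset.sum_comm, Finset.sum_comm (f := fun j i => w i (x (i + j)))]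
      exact Finset.sum_congr rfl fun i _ =>
        (Equiv.sum_comp (Equiv.addLeft i) fun j => w i (x j)).symm
    have h3 := Finset.sum_le_sum fun j (_ : j ∈ Finset.univ) => h1 j
    simp only [Finset.sum_const, Finset.card_univ, Fintype.card_fin, nsmul_eq_mul, ← h2] at h3
    simp only [BoundedContinuousFunction.coe_smul, BoundedContinuousFunction.coe_sum,
      Finset.sum_apply, smul_eq_mul, ← Finset.mul_sum]
    rwa [inv_mul_le_iff₀ hN]
  simp only [BoundedContinuousFunction.coe_smul, BoundedContinuousFunction.coe_sum,
      Finset.sum_apply, smul_eq_mul] at h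
  rwa [integral_const_mul, integral_finsetSum _ fun i _ => (w i).integrable ρ,
    mul_inv_cancel_left₀ hN.ne'] at h

/-- Kantorovich duality for an increasing sequence of symmetric bounded continuous costs: a bound on
the dual problems is a bound on all costs of a single plan. -/
theorem exists_plan_integral_le [ProperSpace X] [NeZero N] (ρ : Measure X) [IsProbabilityMeasure ρ]
    {k : ℕ → ((Fin N → X) →ᵇ ℝ)} (hk : ∀ x, Monotone fun n => k n x)
    (hsymm : ∀ n (σ : Equiv.Perm (Fin N)) x, k n (x ∘ σ) = k n x) {V : ℝ}
    (hV : ∀ n, ∀ u : X →ᵇ ℝ, (∀ x : Fin N → X, ∑ i, u (x i) ≤ k n x) → N * ∫ t, u t ∂ρ ≤ V) :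
    ∃ P : Measure (Fin N → X), IsProbabilityMeasure P ∧ (∀ i, P.map (fun x => x i) = ρ) ∧
      ∀ n, ∫ x, k n x ∂P ≤ V := by
  set Q := Measure.pi fun _ : Fin N => ρ
  -- A normalised functional nonnegative on this cone is positive and satisfies `L (k n) ≤ V` for
  -- all `n` at once. Monotonicity in `n` gives closure under addition.
  let s : PointedCone ℝ ((Fin N → X) →ᵇ ℝ) :=
    { carrier := {f | ∃ t : ℝ, 0 ≤ t ∧ ∃ n, ∀ x, t * (V - k n x) ≤ f x}
      zero_mem' := ⟨0, le_rfl, 0, by simp⟩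
      add_mem' := by
        rintro f g ⟨t, ht, n, hf⟩ ⟨t', ht', n', hg⟩
        refine ⟨t + t', add_nonneg ht ht', max n n', fun x => ?_⟩
        have h1 := mul_le_mul_of_nonneg_left (hk x (le_max_left n n')) ht
        have h2 := mul_le_mul_of_nonneg_left (hk x (le_max_right n n')) ht'
        simp only [BoundedContinuousFunction.coe_add, Pi.add_apply]
        nlinarith [hf x, hg x]
      smul_mem' := by
        rintro ⟨a, ha⟩ f ⟨t, ht, n, hf⟩
        refine ⟨a * t, mul_nonneg ha ht, n, fun x => ?_⟩
        rw [mul_assoc]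
        exact mul_le_mul_of_nonneg_left (hf x) ha }
  have hs0 : ∀ f : (Fin N → X) →ᵇ ℝ, (∀ x, 0 ≤ f x) → f ∈ s := fun f hf =>
    ⟨0, le_rfl, 0, by simpa using hf⟩
  -- On the range of `sumCoord` only the marginals matter; taking the product measure makes the
  -- functional well defined there.
  let I : ((Fin N → X) →ᵇ ℝ) →ₗ[ℝ] ℝ :=
    { toFun := fun f => ∫ x, f x ∂Q
      map_add' := fun f g => integral_add (f.integrable Q) (g.integrable Q)
      map_smul' := fun a f => integral_const_mul a f }
  have hI : ∀ w, I (sumCoord N X w) = ∑ i, ∫ t, w i t ∂ρ := integral_sumCoord ρ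
  -- For `t > 0` the potentials `V / N - wᵢ / t` satisfy the constraint for `k n`, so the dual bound
  -- reads `V - (∑ ∫ wᵢ) / t ≤ V`.
  have hnonneg : ∀ w, sumCoord N X w ∈ s → 0 ≤ ∑ i, ∫ t, w i t ∂ρ := by
    rintro w ⟨t, ht, n, h⟩
    rcases ht.eq_or_lt with rfl | ht
    · rw [← hI]
      exact integral_nonneg fun x => by simpa using h x
    · have h1 := sum_integral_le_of_symmetric ρ (hsymm n) (hV n)
        (fun i => (V / N) • 1 - t⁻¹ • w i) fun x => by
          have h2 := h x
          have h3 := sumCoord_apply (fun i => (V / N) • 1 - t⁻¹ • w i) x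
          have h4 : (fun i => (V / N) • 1 - t⁻¹ • w i) = (fun _ : Fin N => (V / N) • (1 : X →ᵇ ℝ))
            - t⁻¹ • w := rfl
          rw [← h3, h4, map_sub, map_smul, sumCoord_const]
          simp only [BoundedContinuousFunction.coe_sub, BoundedContinuousFunction.coe_smul,
            BoundedContinuousFunction.coe_one, Pi.sub_apply, Pi.one_apply, smul_eq_mul, mul_one]
          have h5 := mul_le_mul_of_nonneg_left h2 (inv_nonneg.2 ht.le)
          rw [inv_mul_cancel_left₀ ht.ne'] at h5
          linarith
      rw [← hI] at h1 ⊢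
      have h4 : (fun i => (V / N) • 1 - t⁻¹ • w i) = (fun _ : Fin N => (V / N) • (1 : X →ᵇ ℝ))
            - t⁻¹ • w := rfl
      have h5 : I (V • 1) = V := by simp [I, Q]
      rw [h4, map_sub, map_smul, sumCoord_const, map_sub, h5, map_smul, smul_eq_mul] at h1
      have h6 : 0 ≤ t⁻¹ * I (sumCoord N X w) := by linarith
      exact (mul_nonneg_iff_of_pos_left (inv_pos.2 ht)).1 h6
  obtain ⟨L, hLd, hLs⟩ := riesz_extension s
    ⟨LinearMap.range (sumCoord N X), I.comp (LinearMap.range (sumCoord N X)).subtype⟩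
    (by
      rintro ⟨_, w, rfl⟩ hx
      exact (hnonneg w hx).trans_eq (hI w).symm)
    (by
      intro f
      refine ⟨⟨_, LinearMap.mem_range_self _ (fun _ => (‖f‖ / N) • 1)⟩, hs0 _ fun x => ?_⟩
      have := (abs_le.1 (f.norm_coe_le_norm x)).1
      simp only [sumCoord_const, BoundedContinuousFunction.coe_add,
        BoundedContinuousFunction.coe_smul, BoundedContinuousFunction.coe_one, Pi.add_apply,
        Pi.one_apply, smul_eq_mul, mul_one]
      linarith)
  have hLw : ∀ w, L (sumCoord N X w) = ∑ i, ∫ t, w i t ∂ρ := fun w =>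
    (hLd ⟨_, LinearMap.mem_range_self _ w⟩).trans (hI w)
  have hL0 : ∀ f : (Fin N → X) →ᵇ ℝ, (∀ x, 0 ≤ f x) → 0 ≤ L f := fun f hf => hLs f (hs0 f hf)
  have hmono : ∀ f g : (Fin N → X) →ᵇ ℝ, (∀ y, f y ≤ g y) → L f ≤ L g := fun f g h => by
    have := hL0 (g - f) fun y => sub_nonneg.2 (h y)
    rwa [map_sub, sub_nonneg] at this
  have hL1 : L 1 = 1 := by
    have h1 := hLw fun _ => ((1 : ℝ) / N) • 1
    rw [← hI, sumCoord_const, one_smul] at h1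
    rw [h1]
    simp [I, Q]
  have htight : Tendsto (fun n => L (cutoff (Fin N → X) n)) atTop (𝓝 1) := by
    have hlow : ∀ n, 1 - ∑ _i : Fin N, ∫ t, (1 - cutoff X n) t ∂ρ ≤ L (cutoff (Fin N → X) n) := by
      intro n
      rw [← hL1, ← hLw fun _ => 1 - cutoff X n, ← map_sub]
      exact hmono _ _ fun x => by
        simpa [sumCoord_apply] using one_sub_sum_le_cutoff n x
    have hint : Tendsto (fun n => ∫ t, (1 - cutoff X n) t ∂ρ) atTop (𝓝 (∫ _, (0 : ℝ) ∂ρ)) := by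
      refine tendsto_integral_of_dominated_convergence (fun _ => 1)
        (fun n => (1 - cutoff X n).continuous.aestronglyMeasurable) (integrable_const _)
        (fun n => .of_forall fun t => ?_) (.of_forall fun t => ?_)
      · have h1 := cutoff_nonneg n t
        have h2 := cutoff_le_one n t
        simp only [BoundedContinuousFunction.coe_sub, BoundedContinuousFunction.coe_one,
          Pi.sub_apply, Pi.one_apply, Real.norm_eq_abs]
        rw [abs_le]
        constructor <;> linarith
      · simpa using (tendsto_cutoff t).const_sub 1
    refine tendsto_of_tendsto_of_tendsto_of_le_of_le ?_ tendsto_const_nhds hlow fun n => ?_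
    · have := (tendsto_finsetSum (Finset.univ : Finset (Fin N)) fun i _ => hint).const_sub 1
      simpa using this
    · rw [← hL1]
      exact hmono _ _ fun x => cutoff_le_one n x
  obtain ⟨P, hP, hPL⟩ := exists_isProbabilityMeasure_integral_eq L hL0 hL1 htight
  refine ⟨P, hP, fun i => ?_, fun n => ?_⟩
  · have : IsProbabilityMeasure (P.map fun x => x i) :=
      Measure.isProbabilityMeasure_map (measurable_pi_apply i).aemeasurable
    refine ext_of_forall_integral_eq_of_IsFiniteMeasure fun φ => ?_
    rw [integral_map (measurable_pi_apply i).aemeasurable φ.continuous.aestronglyMeasurable]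
    simp only [← sumCoord_single i φ]
    rw [hPL, hLw, Finset.sum_eq_single i]
    · simp
    · intro j _ hj
      simp [hj]
    · simp
  · have h1 := hLs (V • 1 - k n) ⟨1, zero_le_one, n, fun x => by simp⟩
    rw [map_sub, map_smul, hL1, ← hPL, smul_eq_mul, mul_one] at h1
    linarith

end Duality

/-! ### A bounded maximiser of the dual problem with bounded cost. -/

theorem ae_pi_of_ae {N : ℕ} {X : Type*} [MeasurableSpace X] {ρ : Measure X}
    [IsProbabilityMeasure ρ] {p : X → Prop} (h : ∀ᵐ t ∂ρ, p t) :
    ∀ᵐ x ∂(Measure.pi fun _ : Fin N => ρ), ∀ i, p (x i) :=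
  ae_all_iff.2 fun i =>
    (measurePreserving_eval (fun _ : Fin N => ρ) i).quasiMeasurePreserving.ae h

/-- For a bounded nonnegative cost, the dual problem has a bounded solution. -/
theorem exists_bounded_dual_optimizer {N : ℕ} [NeZero N] {X : Type*} [TopologicalSpace X]
    [MeasurableSpace X] [BorelSpace X] (ρ : Measure X) [IsProbabilityMeasure ρ]
    {c : (Fin N → X) → ℝ} {B : ℝ} (hc0 : ∀ x, 0 ≤ c x) (hcB : ∀ x, c x ≤ B) :
    ∃ u : X → ℝ, Measurable u ∧ (∀ t, |u t| ≤ B) ∧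
      (∀ᵐ x ∂(Measure.pi fun _ : Fin N => ρ), ∑ i, u (x i) ≤ c x) ∧
      ∀ v : X →ᵇ ℝ, (∀ x : Fin N → X, ∑ i, v (x i) ≤ c x) → ∫ t, v t ∂ρ ≤ ∫ t, u t ∂ρ := by
  have hN : (1 : ℝ) ≤ N := by exact_mod_cast Nat.one_le_iff_ne_zero.2 (NeZero.ne N)
  obtain ⟨⟨t₀⟩⟩ : Nonempty (Nonempty X) := ⟨ρ.nonempty_of_neZero⟩
  have hB : 0 ≤ B := (hc0 fun _ => t₀).trans (hcB _)
  let K : Set (Lp ℝ 2 ρ) := {f | (∀ᵐ t ∂ρ, |f t| ≤ B) ∧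
    ∀ᵐ x ∂(Measure.pi fun _ : Fin N => ρ), ∑ i, f (x i) ≤ c x}
  have hKne : (0 : Lp ℝ 2 ρ) ∈ K := by
    have h0 := Lp.coeFn_zero ℝ 2 ρ
    refine ⟨?_, ?_⟩
    · filter_upwards [h0] with t ht
      simpa [ht] using hB
    · filter_upwards [ae_pi_of_ae h0] with x hx
      simpa [hx] using hc0 x
  have hKc : IsClosed K := by
    refine IsSeqClosed.isClosed fun f g hf hfg => ?_
    obtain ⟨φ, -, hφ⟩ := (tendstoInMeasure_of_tendsto_Lp hfg).exists_seq_tendsto_ae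
    refine ⟨?_, ?_⟩
    · filter_upwards [hφ, ae_all_iff.2 fun n => (hf n).1] with t ht hb
      exact le_of_tendsto ht.abs (.of_forall fun n => hb _)
    · filter_upwards [ae_pi_of_ae hφ, ae_all_iff.2 fun n => (hf n).2] with x hx hb
      exact le_of_tendsto (tendsto_finsetSum _ fun i _ => hx i) (.of_forall fun n => hb _)
  have hKconv : Convex ℝ K := by
    intro f hf g hg a b ha hb hab
    have h : ∀ᵐ t ∂ρ, (a • f + b • g : Lp ℝ 2 ρ) t = a * f t + b * g t := by
      filter_upwards [Lp.coeFn_add (a • f) (b • g), Lp.coeFn_smul a f, Lp.coeFn_smul b g]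
        with t h1 h2 h3
      rw [h1, Pi.add_apply, h2, h3]
      rfl
    refine ⟨?_, ?_⟩
    · filter_upwards [h, hf.1, hg.1] with t ht h1 h2
      rw [ht]
      calc |a * f t + b * g t| ≤ a * |f t| + b * |g t| := by
            refine (abs_add_le _ _).trans_eq ?_
            rw [abs_mul, abs_mul, abs_of_nonneg ha, abs_of_nonneg hb]
        _ ≤ a * B + b * B := by gcongr
        _ = B := by rw [← add_mul, hab, one_mul]
    · filter_upwards [ae_pi_of_ae h, hf.2, hg.2] with x hx h1 h2
      simp only [hx, Finset.sum_add_distrib, ← Finset.mul_sum]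
      calc _ ≤ a * c x + b * c x := by gcongr
        _ = c x := by rw [← add_mul, hab, one_mul]
  have hKb : Bornology.IsBounded K := by
    refine isBounded_iff_forall_norm_le.2 ⟨_, fun f hf => Lp.norm_le_of_ae_bound hB hf.1⟩
  obtain ⟨f, hf, hmax⟩ := exists_forall_le_of_isClosed_convex ⟨0, hKne⟩ hKc hKconv hKb
    (innerSL ℝ (indicatorConstLp 2 MeasurableSet.univ (measure_ne_top ρ _) (1 : ℝ)))
  have hl : ∀ g : Lp ℝ 2 ρ,
      innerSL ℝ (indicatorConstLp 2 MeasurableSet.univ (measure_ne_top ρ _) (1 : ℝ)) g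
        = ∫ t, g t ∂ρ := fun g => by
    rw [innerSL_apply_apply, L2.inner_indicatorConstLp_one, setIntegral_univ]
  have hfu : ∀ᵐ t ∂ρ, f t = max (-B) (min B (f t)) := by
    filter_upwards [hf.1] with t ht
    rw [min_eq_right (abs_le.1 ht).2, max_eq_right (abs_le.1 ht).1]
  refine ⟨fun t => max (-B) (min B (f t)), ?_, fun t => ?_, ?_, fun v hv => ?_⟩
  · exact measurable_const.max (measurable_const.min (Lp.stronglyMeasurable f).measurable)
  · exact abs_le.2 ⟨le_max_left _ _, max_le (by linarith) (min_le_left _ _)⟩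
  · filter_upwards [hf.2, ae_pi_of_ae hfu] with x hx h
    simpa only [← h] using hx
  -- The diagonal configurations bound every competitor above by `B / N`.
  · have hvB : ∀ t, v t ≤ B / N := fun t => by
      have h1 := (hv fun _ => t).trans (hcB _)
      simp only [Finset.sum_const, Finset.card_univ, Fintype.card_fin, nsmul_eq_mul] at h1
      rwa [le_div_iff₀' (by linarith)]
    have hBN : B / N ≤ B := div_le_self hB hN
    -- Raising `v` to `-B` does not decrease its integral. The constraint survives: one term equal
    -- to `-B` offsets all the others, which total at most `B`.
    let w : X → ℝ := fun t => max (-B) (v t)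
    have hwc : Continuous w := continuous_const.max v.continuous
    have hwB : ∀ t, |w t| ≤ B := fun t =>
      abs_le.2 ⟨le_max_left _ _, max_le (by linarith) ((hvB t).trans hBN)⟩
    have hwBN : ∀ t, w t ≤ B / N := fun t =>
      max_le (by have : 0 ≤ B / N := by positivity
                 linarith) (hvB t)
    have hwle : ∀ x : Fin N → X, ∑ i, w (x i) ≤ c x := by
      intro x
      by_cases h : ∃ i, v (x i) < -B
      · obtain ⟨i, hi⟩ := h
        refine le_trans ?_ (hc0 x)
        rw [← Finset.add_sum_erase _ _ (Finset.mem_univ i)]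
        have h1 : w (x i) = -B := max_eq_left hi.le
        have h2 : ∑ j ∈ Finset.univ.erase i, w (x j) ≤ ∑ j ∈ Finset.univ.erase i, B / N :=
          Finset.sum_le_sum fun j _ => hwBN _
        have h3 : ∑ j ∈ Finset.univ.erase i, B / N ≤ ∑ _j : Fin N, B / N :=
          Finset.sum_le_sum_of_subset_of_nonneg (Finset.subset_univ _) fun _ _ _ => by positivity
        have h4 : ∑ _j : Fin N, B / N = B := by
          simp only [Finset.sum_const, Finset.card_univ, Fintype.card_fin, nsmul_eq_mul]
          field_simp
        linarith
      · push Not at h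
        refine le_trans (Finset.sum_le_sum fun i _ => ?_) (hv x)
        exact max_le (h i) le_rfl
    have hwLp : MemLp w 2 ρ := .of_bound hwc.aestronglyMeasurable B (.of_forall hwB)
    have hwK : hwLp.toLp w ∈ K := by
      refine ⟨?_, ?_⟩
      · filter_upwards [hwLp.coeFn_toLp] with t ht
        rw [ht]
        exact hwB t
      · filter_upwards [ae_pi_of_ae hwLp.coeFn_toLp] with x hx
        simpa only [hx] using hwle x
    have h1 := hmax _ hwK
    rw [hl, hl, integral_congr_ae hwLp.coeFn_toLp, integral_congr_ae hfu] at h1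
    refine (integral_mono (v.integrable ρ) (hwLp.integrable (by norm_num)) fun t => ?_).trans h1
    exact le_max_right _ _

/-! ### Weak duality for the Coulomb cost. -/

variable {N : ℕ} {ρ : Measure Space3}

theorem ae_forall_mem_of_mem_transportPlans {P : Measure (Fin N → Space3)}
    (hP : P ∈ transportPlans N ρ) {A : Set Space3} (hA : ∀ᵐ t ∂ρ, t ∈ A) :
    ∀ᵐ x ∂P, ∀ i, x i ∈ A :=
  ae_all_iff.2 fun i => by
    rw [← hP.2 i] at hA
    exact ae_of_ae_map (measurable_pi_apply i).aemeasurable hA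

theorem integrable_apply_of_mem_transportPlans {P : Measure (Fin N → Space3)}
    (hP : P ∈ transportPlans N ρ) {u : Space3 → ℝ} (hu : Integrable u ρ) (i : Fin N) :
    Integrable (fun x => u (x i)) P := by
  rw [← hP.2 i] at hu
  exact hu.comp_measurable (measurable_pi_apply i)

theorem integral_sum_of_mem_transportPlans {P : Measure (Fin N → Space3)}
    (hP : P ∈ transportPlans N ρ) {u : Space3 → ℝ} (hu : Integrable u ρ) :
    ∫ x, ∑ i, u (x i) ∂P = N * ∫ t, u t ∂ρ := by
  rw [integral_finsetSum _ fun i _ => integrable_apply_of_mem_transportPlans hP hu i]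
  have h : ∀ i : Fin N, ∫ x, u (x i) ∂P = ∫ t, u t ∂ρ := fun i => by
    have h1 := hu.aestronglyMeasurable
    rw [← hP.2 i] at h1
    have h2 := integral_map (μ := P) (φ := fun x => x i)
      (measurable_pi_apply i).aemeasurable h1
    rw [hP.2 i] at h2
    exact h2.symm
  simp [h]

theorem continuous_coulombCost : Continuous (coulombCost : (Fin N → Space3) → ℝ≥0∞) := by
  unfold coulombCost
  refine continuous_finsetSum _ fun i _ => continuous_finsetSum _ fun j _ => ?_
  exact (ENNReal.continuous_ofReal.comp (by fun_prop)).inv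

/-- Weak duality. -/
theorem dualObjective_le_planCost [IsProbabilityMeasure ρ] {P : Measure (Fin N → Space3)}
    (hP : P ∈ transportPlans N ρ) {u : Space3 → ℝ} (hu : u ∈ admissiblePotentials N ρ) :
    (dualObjective N ρ u : EReal) ≤ planCost P := by
  obtain ⟨A, hA, hle⟩ := exists_conull_forall_sum_le ρ (c := fun x => (coulombCost x : EReal))
    (fun q => isOpen_lt (continuous_coe_ennreal_ereal.comp continuous_coulombCost)
      continuous_const) hu.2
  rcases eq_or_ne (planCost P) ⊤ with htop | htop
  · simp [htop]
  have hfin : ∀ᵐ x ∂P, coulombCost x < ⊤ :=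
    ae_lt_top continuous_coulombCost.measurable htop
  have h1 : ∫ x, ∑ i, u (x i) ∂P ≤ ∫ x, (coulombCost x).toReal ∂P := by
    refine integral_mono_ae
      (integrable_finsetSum _ fun i _ => integrable_apply_of_mem_transportPlans hP hu.1 i)
      (integrable_toReal_of_lintegral_ne_top continuous_coulombCost.measurable.aemeasurable htop)
      ?_
    filter_upwards [ae_forall_mem_of_mem_transportPlans hP hA, hfin] with x hx hx'
    have := hle x hx
    rwa [← ENNReal.ofReal_toReal hx'.ne, EReal.coe_ennreal_ofReal,
      max_eq_left ENNReal.toReal_nonneg, EReal.coe_le_coe_iff] at this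
  rw [integral_sum_of_mem_transportPlans hP hu.1, integral_toReal
    continuous_coulombCost.measurable.aemeasurable hfin] at h1
  calc (dualObjective N ρ u : EReal) ≤ ((planCost P).toReal : EReal) :=
        EReal.coe_le_coe_iff.2 h1
    _ = planCost P := EReal.coe_ennreal_toReal htop

theorem dualValue_le_planCost [IsProbabilityMeasure ρ] {P : Measure (Fin N → Space3)}
    (hP : P ∈ transportPlans N ρ) : dualValue N ρ ≤ planCost P :=
  iSup₂_le fun _ hu => dualObjective_le_planCost hP hu

/-! ### The truncated Coulomb cost. -/

/-- The Coulomb interaction of two points, truncated at the value `n + 1`. -/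
noncomputable def truncPair (n : ℕ) (x y : Space3) : ℝ := (max ‖x - y‖ (1 / ((n : ℝ) + 1)))⁻¹

theorem truncPair_nonneg (n : ℕ) (x y : Space3) : 0 ≤ truncPair n x y := by
  unfold truncPair
  positivity

theorem lt_max_norm_sub (n : ℕ) (x y : Space3) : 0 < max ‖x - y‖ (1 / ((n : ℝ) + 1)) :=
  lt_max_of_lt_right (by positivity)

theorem truncPair_le (n : ℕ) (x y : Space3) : truncPair n x y ≤ n + 1 := by
  refine inv_le_of_inv_le₀ (by positivity) ?_
  rw [← one_div]
  exact le_max_right _ _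

theorem truncPair_comm (n : ℕ) (x y : Space3) : truncPair n x y = truncPair n y x := by
  rw [truncPair, truncPair, norm_sub_rev]

theorem monotone_truncPair (x y : Space3) : Monotone fun n => truncPair n x y := by
  intro m n hmn
  refine inv_anti₀ (lt_max_norm_sub n x y) (max_le_max le_rfl ?_)
  exact one_div_le_one_div_of_le (by positivity) (by gcongr)

theorem truncPair_le_inv {n : ℕ} {x y : Space3} {r : ℝ} (hr : 0 < r) (h : r ≤ ‖x - y‖) :
    truncPair n x y ≤ r⁻¹ :=
  inv_anti₀ hr (h.trans (le_max_left _ _))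

theorem continuous_truncPair {Z : Type*} [TopologicalSpace Z] (n : ℕ) {f g : Z → Space3}
    (hf : Continuous f) (hg : Continuous g) : Continuous fun z => truncPair n (f z) (g z) :=
  ((hf.sub hg).norm.max continuous_const).inv₀ fun z => (lt_max_norm_sub n (f z) (g z)).ne'

theorem ofReal_truncPair (n : ℕ) (x y : Space3) : ENNReal.ofReal (truncPair n x y)
    = (max (ENNReal.ofReal ‖x - y‖) (ENNReal.ofReal (1 / ((n : ℝ) + 1))))⁻¹ := by
  rw [truncPair, ENNReal.ofReal_inv_of_pos (lt_max_norm_sub n x y), ENNReal.ofReal_max]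

theorem ofReal_truncPair_le (n : ℕ) (x y : Space3) :
    ENNReal.ofReal (truncPair n x y) ≤ (ENNReal.ofReal ‖x - y‖)⁻¹ := by
  rw [ofReal_truncPair]
  exact ENNReal.inv_le_inv.2 (le_max_left _ _)

/-- An active truncation takes exactly the value `n + 1`, so a strictly smaller value is the true
interaction. -/
theorem ofReal_truncPair_eq {n : ℕ} {x y : Space3} (h : truncPair n x y < n + 1) :
    ENNReal.ofReal (truncPair n x y) = (ENNReal.ofReal ‖x - y‖)⁻¹ := by
  rw [ofReal_truncPair, max_eq_left]
  refine ENNReal.ofReal_le_ofReal (le_of_not_gt fun hlt => h.ne ?_)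
  rw [truncPair, max_eq_right hlt.le, one_div, inv_inv]

theorem tendsto_ofReal_truncPair (x y : Space3) :
    Tendsto (fun n => ENNReal.ofReal (truncPair n x y)) atTop (𝓝 (ENNReal.ofReal ‖x - y‖)⁻¹) := by
  simp only [ofReal_truncPair]
  refine Tendsto.inv ?_
  have h := (ENNReal.tendsto_ofReal (tendsto_one_div_add_atTop_nhds_zero_nat (𝕜 := ℝ)))
  simpa using (tendsto_const_nhds (x := ENNReal.ofReal ‖x - y‖)).max h

/-- The Coulomb cost with pair interactions truncated at the value `n + 1`. -/
noncomputable def truncCost (N n : ℕ) : (Fin N → Space3) →ᵇ ℝ :=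
  .ofNormedAddCommGroup (fun x => ∑ i, ∑ j with i < j, truncPair n (x i) (x j))
    (continuous_finsetSum _ fun i _ => continuous_finsetSum _ fun j _ =>
      continuous_truncPair n (continuous_apply i) (continuous_apply j))
    (∑ i : Fin N, ∑ j : Fin N with i < j, ((n : ℝ) + 1)) fun x => by
      rw [Real.norm_of_nonneg
        (Finset.sum_nonneg fun i _ => Finset.sum_nonneg fun j _ => truncPair_nonneg _ _ _)]
      exact Finset.sum_le_sum fun i _ => Finset.sum_le_sum fun j _ => truncPair_le _ _ _

theorem truncCost_apply (n : ℕ) (x : Fin N → Space3) :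
    truncCost N n x = ∑ i, ∑ j with i < j, truncPair n (x i) (x j) := rfl

theorem truncCost_nonneg (n : ℕ) (x : Fin N → Space3) : 0 ≤ truncCost N n x := by
  rw [truncCost_apply]
  exact Finset.sum_nonneg fun i _ => Finset.sum_nonneg fun j _ => truncPair_nonneg _ _ _

theorem monotone_truncCost (x : Fin N → Space3) : Monotone fun n => truncCost N n x := by
  intro m n hmn
  simp only [truncCost_apply]
  exact Finset.sum_le_sum fun _ _ => Finset.sum_le_sum fun _ _ => monotone_truncPair _ _ hmn

/-- Unlike `i < j`, the relation `i ≠ j` is invariant under permutations, which yields the symmetry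
of the cost. -/
theorem sum_sum_lt_eq_half {g : Fin N → Fin N → ℝ} (hg : ∀ i j, g i j = g j i) :
    ∑ i, ∑ j with i < j, g i j = (∑ i, ∑ j with i ≠ j, g i j) / 2 := by
  have h1 : ∑ i, ∑ j with i ≠ j, g i j = ∑ i, ∑ j with i < j, g i j + ∑ i, ∑ j with j < i, g i j := by
    rw [← Finset.sum_add_distrib]
    refine Finset.sum_congr rfl fun i _ => ?_
    simp only [Finset.sum_filter, ← Finset.sum_add_distrib]
    refine Finset.sum_congr rfl fun j _ => ?_
    rcases lt_trichotomy i j with h | rfl | h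
    · simp [h, h.ne, h.not_gt]
    · simp
    · simp [h, h.ne', h.not_gt]
  have h2 : ∑ i, ∑ j with j < i, g i j = ∑ i, ∑ j with i < j, g i j := by
    simp only [Finset.sum_filter]
    rw [Finset.sum_comm]
    simp only [hg]
  rw [h1, h2]
  ring

theorem truncCost_comp_perm (n : ℕ) (σ : Equiv.Perm (Fin N)) (x : Fin N → Space3) :
    truncCost N n (x ∘ σ) = truncCost N n x := by
  rw [truncCost_apply, truncCost_apply,
    sum_sum_lt_eq_half (g := fun i j => truncPair n ((x ∘ σ) i) ((x ∘ σ) j))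
      fun i j => truncPair_comm _ _ _,
    sum_sum_lt_eq_half (g := fun i j => truncPair n (x i) (x j)) fun i j => truncPair_comm _ _ _]
  congr 1
  simp only [Finset.sum_filter, Function.comp_apply]
  rw [← Equiv.sum_comp σ fun i => ∑ j, if i ≠ j then truncPair n (x i) (x j) else 0]
  refine Finset.sum_congr rfl fun i _ => ?_
  rw [← Equiv.sum_comp σ fun j => if σ i ≠ j then truncPair n (x (σ i)) (x j) else 0]
  simp

theorem ofReal_truncCost (n : ℕ) (x : Fin N → Space3) : ENNReal.ofReal (truncCost N n x)
    = ∑ i, ∑ j with i < j, ENNReal.ofReal (truncPair n (x i) (x j)) := by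
  rw [truncCost_apply, ENNReal.ofReal_sum_of_nonneg
    fun i _ => Finset.sum_nonneg fun j _ => truncPair_nonneg _ _ _]
  refine Finset.sum_congr rfl fun i _ => ?_
  rw [ENNReal.ofReal_sum_of_nonneg fun j _ => truncPair_nonneg _ _ _]

theorem ofReal_truncCost_le (n : ℕ) (x : Fin N → Space3) :
    ENNReal.ofReal (truncCost N n x) ≤ coulombCost x := by
  rw [ofReal_truncCost]
  exact Finset.sum_le_sum fun i _ => Finset.sum_le_sum fun j _ => ofReal_truncPair_le _ _ _

theorem ofReal_truncCost_eq {n : ℕ} {x : Fin N → Space3}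
    (h : ∀ i j, i < j → truncPair n (x i) (x j) < n + 1) :
    ENNReal.ofReal (truncCost N n x) = coulombCost x := by
  rw [ofReal_truncCost]
  exact Finset.sum_congr rfl fun i _ => Finset.sum_congr rfl fun j hj =>
    ofReal_truncPair_eq (h i j (Finset.mem_filter.1 hj).2)

theorem tendsto_ofReal_truncCost (x : Fin N → Space3) :
    Tendsto (fun n => ENNReal.ofReal (truncCost N n x)) atTop (𝓝 (coulombCost x)) := by
  simp only [ofReal_truncCost]
  exact tendsto_finsetSum _ fun i _ => tendsto_finsetSum _ fun j _ =>
    tendsto_ofReal_truncPair _ _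

theorem coe_le_coulombCost_of_le_truncCost {n : ℕ} {a : ℝ} {x : Fin N → Space3}
    (h : a ≤ truncCost N n x) : (a : EReal) ≤ (coulombCost x : EReal) :=
  calc (a : EReal) ≤ ((ENNReal.ofReal (truncCost N n x) : ℝ≥0∞) : EReal) := by
        rw [EReal.coe_ennreal_ofReal, max_eq_left (truncCost_nonneg n x)]
        exact EReal.coe_le_coe_iff.2 h
    _ ≤ _ := EReal.coe_ennreal_le_coe_ennreal_iff.2 (ofReal_truncCost_le n x)

/-! ### Separation by exchanging points. -/

/-- If exchanging the `p`-th points of two configurations does not decrease the total truncated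
cost, and those points are far from the other points of the other configuration, then the `p`-th
point of the first configuration is not close to its other points. -/
theorem truncPair_le_of_swap {n : ℕ} {x y : Fin N → Space3} {p q : Fin N} {r : ℝ} (hr : 0 < r)
    (hpq : p < q) (hyx : ∀ j, j ≠ p → r ≤ ‖y p - x j‖) (hxy : ∀ j, j ≠ p → r ≤ ‖x p - y j‖)
    (h : truncCost N n x + truncCost N n y ≤
      truncCost N n (Function.update x p (y p)) + truncCost N n (Function.update y p (x p))) :
    truncPair n (x p) (x q) ≤ ∑ i : Fin N, ∑ j : Fin N with i < j, 2 * r⁻¹ := by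
  set x' := Function.update x p (y p)
  set y' := Function.update y p (x p)
  have hx'p : x' p = y p := Function.update_self _ _ _
  have hy'p : y' p = x p := Function.update_self _ _ _
  have hx' : ∀ j, j ≠ p → x' j = x j := fun j hj => Function.update_of_ne hj _ _
  have hy' : ∀ j, j ≠ p → y' j = y j := fun j hj => Function.update_of_ne hj _ _
  -- Pairs avoiding `p` cancel, and the two exchanged interactions of any other pair cost at most `2
  -- * r⁻¹`. Adding this constant makes every term nonnegative, so the total dominates the `(p, q)`
  -- term.
  let b : Fin N → Fin N → ℝ := fun i j => 2 * r⁻¹ - truncPair n (x' i) (x' j)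
    - truncPair n (y' i) (y' j) + truncPair n (x i) (x j) + truncPair n (y i) (y j)
  have hfar : ∀ j, j ≠ p → truncPair n (y p) (x j) + truncPair n (x p) (y j) ≤ 2 * r⁻¹ :=
    fun j hj => by
      have h1 := truncPair_le_inv (n := n) hr (hyx j hj)
      have h2 := truncPair_le_inv (n := n) hr (hxy j hj)
      linarith
  have hb : ∀ i j, i < j → 0 ≤ b i j := by
    intro i j hij
    have h1 := truncPair_nonneg n (x i) (x j)
    have h2 := truncPair_nonneg n (y i) (y j)
    by_cases hi : i = p
    · subst hi
      have h3 := hfar j hij.ne'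
      simp only [b, hx'p, hy'p, hx' j hij.ne', hy' j hij.ne']
      linarith
    by_cases hj : j = p
    · subst hj
      have h3 := hfar i hi
      simp only [b, hx'p, hy'p, hx' i hi, hy' i hi]
      rw [truncPair_comm n (x i) (y j), truncPair_comm n (y i) (x j)]
      linarith
    · simp only [b, hx' i hi, hy' i hi, hx' j hj, hy' j hj]
      have : 0 ≤ 2 * r⁻¹ := by positivity
      linarith
  have hbpq : truncPair n (x p) (x q) ≤ b p q := by
    have h2 := truncPair_nonneg n (y p) (y q)
    have h3 := hfar q hpq.ne'
    simp only [b, hx'p, hy'p, hx' q hpq.ne', hy' q hpq.ne']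
    linarith
  have hsum : ∑ i, ∑ j with i < j, b i j = (∑ i : Fin N, ∑ j : Fin N with i < j, 2 * r⁻¹)
      - truncCost N n x' - truncCost N n y' + truncCost N n x + truncCost N n y := by
    simp only [b, truncCost_apply, Finset.sum_add_distrib, Finset.sum_sub_distrib]
  calc truncPair n (x p) (x q) ≤ b p q := hbpq
    _ ≤ ∑ j with p < j, b p j :=
        Finset.single_le_sum (f := fun j => b p j) (fun j hj => hb p j (Finset.mem_filter.1 hj).2)
          (Finset.mem_filter.2 ⟨Finset.mem_univ q, hpq⟩)
    _ ≤ ∑ i, ∑ j with i < j, b i j :=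
        Finset.single_le_sum (f := fun i => ∑ j with i < j, b i j)
          (fun i _ => Finset.sum_nonneg fun j hj => hb i j (Finset.mem_filter.1 hj).2)
          (Finset.mem_univ p)
    _ ≤ _ := by rw [hsum]; linarith

/-! ### An optimal plan and the absence of a duality gap. -/

theorem dualObjective_le_dualValue {u : Space3 → ℝ} (hu : u ∈ admissiblePotentials N ρ) :
    (dualObjective N ρ u : EReal) ≤ dualValue N ρ :=
  le_iSup₂_of_le u hu le_rfl

theorem dualValue_nonneg : 0 ≤ dualValue N ρ := by
  have h : (0 : Space3 → ℝ) ∈ admissiblePotentials N ρ :=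
    ⟨integrable_zero _ _ _, .of_forall fun x => by simpa using EReal.coe_ennreal_nonneg _⟩
  simpa [dualObjective] using dualObjective_le_dualValue h

theorem pi_mem_transportPlans [IsProbabilityMeasure ρ] :
    (Measure.pi fun _ : Fin N => ρ) ∈ transportPlans N ρ :=
  ⟨inferInstance, fun i => (measurePreserving_eval (fun _ : Fin N => ρ) i).map_eq⟩

/-- There is a transport plan whose cost is at most the value of the dual problem. -/
theorem exists_planCost_le_dualValue [NeZero N] [IsProbabilityMeasure ρ] :
    ∃ P ∈ transportPlans N ρ, (planCost P : EReal) ≤ dualValue N ρ := by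
  rcases eq_or_ne (dualValue N ρ) ⊤ with htop | htop
  · exact ⟨_, pi_mem_transportPlans, htop ▸ le_top⟩
  have hV : ((dualValue N ρ).toReal : EReal) = dualValue N ρ :=
    EReal.coe_toReal htop (ne_bot_of_le_ne_bot (by simp) dualValue_nonneg)
  obtain ⟨P, hP, hmarg, hle⟩ := exists_plan_integral_le (N := N) ρ (k := truncCost N)
    monotone_truncCost truncCost_comp_perm (V := (dualValue N ρ).toReal) fun n u hu => by
      rw [← EReal.coe_le_coe_iff, hV]
      exact dualObjective_le_dualValue ⟨u.integrable ρ, .of_forall fun x =>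
        coe_le_coulombCost_of_le_truncCost (hu x)⟩
  refine ⟨P, ⟨hP, hmarg⟩, ?_⟩
  have h : planCost P ≤ ENNReal.ofReal (dualValue N ρ).toReal := by
    calc planCost P = ∫⁻ x, liminf (fun n => ENNReal.ofReal (truncCost N n x)) atTop ∂P := by
          simp only [fun x => (tendsto_ofReal_truncCost (N := N) x).liminf_eq, planCost]
      _ ≤ liminf (fun n => ∫⁻ x, ENNReal.ofReal (truncCost N n x) ∂P) atTop :=
          lintegral_liminf_le fun n => (truncCost N n).continuous.measurable.ennreal_ofReal
      _ ≤ liminf (fun _ : ℕ => ENNReal.ofReal (dualValue N ρ).toReal) atTop := by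
          refine liminf_le_liminf (.of_forall fun n => ?_)
          rw [← ofReal_integral_eq_lintegral_ofReal ((truncCost N n).integrable P)
            (.of_forall (truncCost_nonneg n))]
          exact ENNReal.ofReal_le_ofReal (hle n)
      _ = _ := liminf_const _
  calc (planCost P : EReal) ≤ (ENNReal.ofReal (dualValue N ρ).toReal : EReal) :=
        EReal.coe_ennreal_le_coe_ennreal_iff.2 h
    _ = dualValue N ρ := by
        rw [EReal.coe_ennreal_ofReal, max_eq_left (EReal.toReal_nonneg dualValue_nonneg), hV]

/-! ### Bounded optimal potentials for measures without atoms. -/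

/-- If balls of radius `r` have small mass, then any configuration and any conull set of
configurations admit in that set a configuration far from the given one. -/
theorem exists_far_configuration [NeZero N] [IsProbabilityMeasure ρ]
    {P : Measure (Fin N → Space3)} (hP : P ∈ transportPlans N ρ) {r : ℝ}
    (hr : ∀ z, ρ (Metric.ball z r) < ENNReal.ofReal (1 / (4 * N))) {G : Set (Fin N → Space3)}
    (hG : ∀ᵐ y ∂P, y ∈ G) (x : Fin N → Space3) (p : Fin N) :
    ∃ y ∈ G, (∀ j, r ≤ ‖y p - x j‖) ∧ ∀ j, r ≤ ‖x p - y j‖ := by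
  have := hP.1
  by_contra! h
  -- The bad set is a union of `2 * N` events of mass at most `1 / (4 * N)`, hence of mass at most
  -- `1 / 2`.
  let S := (⋃ j, (fun y : Fin N → Space3 => y p) ⁻¹' Metric.ball (x j) r) ∪
    ⋃ j, (fun y : Fin N → Space3 => y j) ⁻¹' Metric.ball (x p) r
  have hpre : ∀ i z, P ((fun y : Fin N → Space3 => y i) ⁻¹' Metric.ball z r)
      ≤ ENNReal.ofReal (1 / (4 * N)) := fun i z => by
    rw [← Measure.map_apply (measurable_pi_apply i) Metric.isOpen_ball.measurableSet, hP.2 i]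
    exact (hr z).le
  have hN : (0 : ℝ) < N := by exact_mod_cast Nat.pos_of_neZero N
  have hsum : ∀ s : Fin N → Set (Fin N → Space3),
      (∀ j, P (s j) ≤ ENNReal.ofReal (1 / (4 * N))) → P (⋃ j, s j) ≤ ENNReal.ofReal (1 / 4) := by
    intro s hs
    calc P (⋃ j, s j) ≤ ∑ j, P (s j) := measure_iUnion_fintype_le _ _
      _ ≤ ∑ _j : Fin N, ENNReal.ofReal (1 / (4 * N)) := Finset.sum_le_sum fun j _ => hs j
      _ = ENNReal.ofReal (1 / 4) := by
        rw [Finset.sum_const, Finset.card_univ, Fintype.card_fin, ← ENNReal.ofReal_nsmul]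
        congr 1
        rw [nsmul_eq_mul]
        field_simp
  have hS : P S < 1 := by
    calc P S ≤ ENNReal.ofReal (1 / 4) + ENNReal.ofReal (1 / 4) :=
          (measure_union_le _ _).trans (add_le_add (hsum _ fun j => hpre p (x j))
            (hsum _ fun j => hpre j (x p)))
      _ = ENNReal.ofReal (1 / 4 + 1 / 4) :=
          (ENNReal.ofReal_add (by norm_num) (by norm_num)).symm
      _ < 1 := by
          rw [← ENNReal.ofReal_one]
          exact (ENNReal.ofReal_lt_ofReal_iff one_pos).2 (by norm_num)
  refine hS.not_ge ?_
  rw [← measure_univ (μ := P)]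
  refine measure_mono_ae ?_
  filter_upwards [hG] with y hy _
  by_cases h1 : ∀ j, r ≤ ‖y p - x j‖
  · obtain ⟨j, hj⟩ := h y hy h1
    refine Or.inr (Set.mem_iUnion.2 ⟨j, ?_⟩)
    rwa [Set.mem_preimage, mem_ball_iff_norm']
  · push Not at h1
    obtain ⟨j, hj⟩ := h1
    refine Or.inl (Set.mem_iUnion.2 ⟨j, ?_⟩)
    rwa [Set.mem_preimage, mem_ball_iff_norm]

/-- For a measure without atoms, the dual problem has a bounded solution. -/
theorem exists_bounded_potential [NeZero N] [IsProbabilityMeasure ρ] (hρ : ∀ x, ρ {x} = 0) :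
    ∃ u ∈ admissiblePotentials N ρ, (∃ C : ℝ, ∀ x, |u x| ≤ C) ∧
      (dualObjective N ρ u : EReal) = dualValue N ρ := by
  have hN : (0 : ℝ) < N := by exact_mod_cast Nat.pos_of_neZero N
  obtain ⟨r, hr, hball⟩ := exists_forall_measure_ball_lt ρ hρ
    (ε := ENNReal.ofReal (1 / (4 * N))) (ENNReal.ofReal_pos.2 (by positivity))
  -- The exchange bound depends only on `N` and `r`, so the truncation level can be chosen above it
  -- in advance.
  obtain ⟨n, hn⟩ := exists_nat_gt (∑ i : Fin N, ∑ j : Fin N with i < j, 2 * r⁻¹)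
  obtain ⟨u, hum, huB, hu, hmax⟩ := exists_bounded_dual_optimizer (N := N) ρ (c := truncCost N n)
    (truncCost_nonneg n) fun x => (le_abs_self _).trans ((truncCost N n).norm_coe_le_norm x)
  have huint : Integrable u ρ := .of_bound hum.aestronglyMeasurable _ (.of_forall huB)
  have hadm : u ∈ admissiblePotentials N ρ := ⟨huint, by
    filter_upwards [hu] with x hx using coe_le_coulombCost_of_le_truncCost hx⟩
  refine ⟨u, hadm, ⟨_, huB⟩, le_antisymm (dualObjective_le_dualValue hadm) ?_⟩
  -- With a constant sequence of costs, the duality theorem gives a plan optimal for this single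
  -- truncated cost.
  obtain ⟨P, hP, hmarg, hle⟩ := exists_plan_integral_le (N := N) ρ (k := fun _ => truncCost N n)
    (fun x => monotone_const) (fun _ => truncCost_comp_perm n) (V := N * ∫ t, u t ∂ρ)
    fun _ v hv => by
      have := hmax v hv
      gcongr
  have hplan : P ∈ transportPlans N ρ := ⟨hP, hmarg⟩
  obtain ⟨A, hA, hleA⟩ := exists_conull_forall_sum_le ρ (u := u)
    (c := fun x : Fin N → Space3 => (truncCost N n x : EReal))
    (fun q => isOpen_lt (continuous_coe_real_ereal.comp (truncCost N n).continuous)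
      continuous_const) (by
        filter_upwards [hu] with x hx using EReal.coe_le_coe_iff.2 hx)
  replace hleA : ∀ x : Fin N → Space3, (∀ i, x i ∈ A) → ∑ i, u (x i) ≤ truncCost N n x :=
    fun x hx => EReal.coe_le_coe_iff.1 (hleA x hx)
  have hAP := ae_forall_mem_of_mem_transportPlans hplan hA
  have hae : ∀ᵐ x ∂P, ∑ i, u (x i) ≤ truncCost N n x := hAP.mono hleA
  have hsint : Integrable (fun x => ∑ i, u (x i)) P :=
    integrable_finsetSum _ fun i _ => integrable_apply_of_mem_transportPlans hplan huint i
  -- Complementary slackness: a pointwise inequality whose integrals agree is an equality a.e.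
  have heq : (fun x => ∑ i, u (x i)) =ᵐ[P] truncCost N n :=
    (integral_eq_iff_of_ae_le hsint ((truncCost N n).integrable P) hae).1
      (le_antisymm (integral_mono_ae hsint ((truncCost N n).integrable P) hae)
        ((hle 0).trans_eq (integral_sum_of_mem_transportPlans hplan huint).symm))
  have hG : ∀ᵐ x ∂P, x ∈ {x : Fin N → Space3 | (∀ i, x i ∈ A) ∧ ∑ i, u (x i) = truncCost N n x} :=
    hAP.and heq
  have hsep : ∀ᵐ x ∂P, ENNReal.ofReal (truncCost N n x) = coulombCost x := by
    filter_upwards [hG] with x hx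
    refine ofReal_truncCost_eq fun p q hpq => ?_
    obtain ⟨y, hy, hyx, hxy⟩ := exists_far_configuration hplan hball hG x p
    refine (truncPair_le_of_swap (y := y) hr hpq (fun j _ => hyx j) (fun j _ => hxy j) ?_).trans_lt
      (hn.trans (lt_add_one _))
    have hmem : ∀ v w : Fin N → Space3, (∀ i, v i ∈ A) → (∀ i, w i ∈ A) →
        ∀ i, Function.update v p (w p) i ∈ A := by
      intro v w hv hw i
      rcases eq_or_ne i p with rfl | hi
      · rw [Function.update_self]
        exact hw i
      · rw [Function.update_of_ne hi]
        exact hv i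
    have hupd : ∀ v w : Fin N → Space3, ∑ i, u (Function.update v p (w p) i)
        = u (w p) - u (v p) + ∑ i, u (v i) := by
      intro v w
      rw [← Finset.add_sum_erase _ _ (Finset.mem_univ p),
        ← Finset.add_sum_erase _ (fun i => u (v i)) (Finset.mem_univ p), Function.update_self,
        Finset.sum_congr rfl fun i hi => by
          rw [Function.update_of_ne (Finset.ne_of_mem_erase hi)]]
      ring
    -- The exchange preserves the combined sum of `u` over both configurations; equality at `x` and
    -- `y` then shows that it cannot lower the total truncated cost.
    have h1 := hleA _ (hmem x y hx.1 hy.1)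
    have h2 := hleA _ (hmem y x hy.1 hx.1)
    rw [hupd] at h1 h2
    rw [← hx.2, ← hy.2]
    linarith
  have hnonneg : 0 ≤ N * ∫ t, u t ∂ρ :=
    (integral_nonneg (truncCost_nonneg n)).trans (hle 0)
  calc dualValue N ρ ≤ planCost P := dualValue_le_planCost hplan
    _ = (ENNReal.ofReal (∫ x, truncCost N n x ∂P) : EReal) := by
        rw [ofReal_integral_eq_lintegral_ofReal ((truncCost N n).integrable P)
          (.of_forall (truncCost_nonneg n)), lintegral_congr_ae hsep, planCost]
    _ ≤ (ENNReal.ofReal (N * ∫ t, u t ∂ρ) : EReal) :=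
        EReal.coe_ennreal_le_coe_ennreal_iff.2 (ENNReal.ofReal_le_ofReal (hle 0))
    _ = dualObjective N ρ u := by
        rw [EReal.coe_ennreal_ofReal, max_eq_left hnonneg, dualObjective]

end CoulombOT

theorem mainTheorem1 (N : ℕ) (hN : 1 ≤ N)
    (ρ : MeasureTheory.Measure CoulombOT.Space3) [MeasureTheory.IsProbabilityMeasure ρ] :
    (∃ P ∈ CoulombOT.transportPlans N ρ,
      (∀ Q ∈ CoulombOT.transportPlans N ρ, CoulombOT.planCost P ≤ CoulombOT.planCost Q) ∧
      (CoulombOT.planCost P : EReal) = CoulombOT.dualValue N ρ) ∧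
    ((∀ x : CoulombOT.Space3, ρ {x} = 0) →
      ∃ u ∈ CoulombOT.admissiblePotentials N ρ,
        (∃ C : ℝ, ∀ x, |u x| ≤ C) ∧
        (CoulombOT.dualObjective N ρ u : EReal) = CoulombOT.dualValue N ρ) := by
  have : NeZero N := ⟨by omega⟩
  refine ⟨?_, CoulombOT.exists_bounded_potential⟩
  obtain ⟨P, hP, hle⟩ := CoulombOT.exists_planCost_le_dualValue (N := N) (ρ := ρ)
  exact ⟨P, hP, fun Q hQ => EReal.coe_ennreal_le_coe_ennreal_iff.1
    (hle.trans (CoulombOT.dualValue_le_planCost hQ)),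
    le_antisymm hle (CoulombOT.dualValue_le_planCost hP)⟩
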